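/- Let $D$ be a diagram of a knot $K$ with a base point $b$ on an arc of $D$, and let $p$ be a prime number. Let $A=\mathbb{Z}[x]/(x^2-x)$ be the Frobenius algebra with $\Delta(1)=1\otimes x+x\otimes 1-1\otimes 1$, $\Delta(x)=x\otimes x$, $\varepsilon(1)=0$, $\varepsilon(x)=1$. Let $C^\ast=C^\ast_{\mathrm{BN}}(D;\mathbb{Z})$ be the integral Bar-Natan complex, i.e. the cube-of-smoothings complex of $D$ built from $A$, whose cochain groups $\bigoplus_S A^{\otimes\{\text{circles of }S\}}$ carry the homological and quantum grading of the Khovanov complex ($1$ and $x$ contribute $+1$ and $-1$ to the quantum degree). It is filtered by the subcomplexes $\mathcal{F}_q$ spanned by the standard generators (tensors of $1$ and $x$) of quantum degree at least $q$. The reduced Bar-Natan complex is $\tilde C^\ast=\tilde C^\ast_{\mathrm{BN}}(D;\mathbb{Z})=x\,C^\ast$, where $x$ acts by multiplication on the tensor factor of the circle through $b$, filtered by $\tilde{\mathcal{F}}_q=x\,\mathcal{F}_{q+1}$. For a cochain complex $X^\ast$ with a descending filtration $(\mathcal{G}_q)$, put $H^\ast(X)_q=\operatorname{im}(H^\ast(\mathcal{G}_q)\to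 H^\ast(X))$ and $H^\ast(X)^{(q)}=H^\ast(X)_q/H^\ast(X)_{q+2}$, and call $H^\ast(X)$ graded $p$-torsion free if none of the groups $H^i(X)^{(q)}$ contains an element of order $p$. Then the reduced Bar-Natan cohomology $H^\ast(\tilde C)=\tilde H^\ast_{\mathrm{BN}}(K;\mathbb{Z})$ is graded $p$-torsion free if and only if the unreduced Bar-Natan cohomology $H^\ast(C)=H^\ast_{\mathrm{BN}}(K;\mathbb{Z})$ is graded $p$-torsion free. -/

import Mathlib

noncomputable section

open scoped Classical

/-! ## Cohomology of subcomplexes, induced filtrations, graded torsion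

The ambient object is a family of modules `C i` with maps `d i j : C i → C j`, where only
`d i (i + 1)` matters.  A subcomplex is a family `U i` of submodules. -/

section Cohomology

variable {R : Type*} [CommRing R] {C : ℤ → Type*} [∀ i, AddCommGroup (C i)] [∀ i, Module R (C i)]

/-- The degree `i` cocycles of the subcomplex `U`. -/
def cocycles (d : ∀ i j, C i →ₗ[R] C j) (U : ∀ i, Submodule R (C i)) (i : ℤ) :
    Submodule R (C i) :=
  U i ⊓ LinearMap.ker (d i (i + 1))

/-- The degree `i` coboundaries of the subcomplex `U`. -/
def coboundaries (d : ∀ i j, C i →ₗ[R] C j) (U : ∀ i, Submodule R (C i)) (i : ℤ) :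
    Submodule R (C i) :=
  (U (i - 1)).map (d (i - 1) i)

/-- The cohomology `Hⁱ(U)`: cocycles modulo coboundaries. -/
abbrev Cohomology (d : ∀ i j, C i →ₗ[R] C j) (U : ∀ i, Submodule R (C i)) (i : ℤ) : Type _ :=
  (cocycles d U i) ⧸ (coboundaries d U i).submoduleOf (cocycles d U i)

theorem cocycles_mono (d : ∀ i j, C i →ₗ[R] C j) {U V : ∀ i, Submodule R (C i)}
    (h : ∀ i, U i ≤ V i) (i : ℤ) : cocycles d U i ≤ cocycles d V i :=
  inf_le_inf_right _ (h i)

/-- The map `Hⁱ(U) → Hⁱ(V)` induced by an inclusion `U ⊆ V` of subcomplexes. -/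
def cohomologyMap (d : ∀ i j, C i →ₗ[R] C j) {U V : ∀ i, Submodule R (C i)}
    (h : ∀ i, U i ≤ V i) (i : ℤ) : Cohomology d U i →ₗ[R] Cohomology d V i :=
  Submodule.mapQ _ _ (Submodule.inclusion (cocycles_mono d h i))
    (fun _ hx => Submodule.map_mono (h (i - 1)) hx)

/-- A complex `tot` (a subcomplex of the ambient `C`) together with a descending filtration
`F q`, `q ∈ ℤ`, by subcomplexes. -/
structure Filtration (R : Type*) [CommRing R] (C : ℤ → Type*) [∀ i, AddCommGroup (C i)]
    [∀ i, Module R (C i)] where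
  tot : ∀ i, Submodule R (C i)
  F : ℤ → ∀ i, Submodule R (C i)
  le_tot : ∀ q i, F q i ≤ tot i
  anti : ∀ q r, q ≤ r → ∀ i, F r i ≤ F q i

/-- The induced filtration `Hⁱ(C)_q = im (Hⁱ(F_q) → Hⁱ(C))`. -/
def inducedFiltration (d : ∀ i j, C i →ₗ[R] C j) (𝓕 : Filtration R C) (q i : ℤ) :
    Submodule R (Cohomology d 𝓕.tot i) :=
  LinearMap.range (cohomologyMap d (𝓕.le_tot q) i)

/-- The associated graded cohomology group `Hⁱ(C)^(q) = Hⁱ(C)_q / Hⁱ(C)_{q+2}`. -/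
abbrev GradedCohomology (d : ∀ i j, C i →ₗ[R] C j) (𝓕 : Filtration R C) (q i : ℤ) : Type _ :=
  (inducedFiltration d 𝓕 q i) ⧸
    (inducedFiltration d 𝓕 (q + 2) i).submoduleOf (inducedFiltration d 𝓕 q i)

/-- No associated graded cohomology group contains an element of order `p`. -/
def GradedTorsionFreeAt (p : ℕ) (d : ∀ i j, C i →ₗ[R] C j) (𝓕 : Filtration R C) : Prop :=
  ∀ q i : ℤ, ∀ a : GradedCohomology d 𝓕 q i, addOrderOf a ≠ p

end Cohomology

/-! ## Knot diagrams -/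

/-- A signed Gauss code with `n` crossings.  The knot is traversed once from an auxiliary starting
point that is not a crossing, which gives `2n` passages through crossings;
`passage (c, true)` and `passage (c, false)` are the times at which one runs through the crossing
`c` along the over- and the under-strand.  `positive c` says that `c` is a positive crossing. -/
structure SignedGaussCode where
  n : ℕ
  passage : Fin n × Bool ≃ Fin (2 * n)
  positive : Fin n → Prop

namespace SignedGaussCode

variable (G : SignedGaussCode)

/-- The `2n` passages and the starting point cut the knot into `2n + 1` arcs, numbered in order of
traversal.  The last arc is continued by arc `0` at the starting point. -/
abbrev Arc : Type := Fin (2 * G.n + 1)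

/-- The arc entering the crossing `c` along the over-strand (`o = true`) or under-strand. -/
def arcIn (c : Fin G.n) (o : Bool) : G.Arc := (G.passage (c, o)).castSucc

/-- The arc leaving the crossing `c` along the over-strand (`o = true`) or under-strand. -/
def arcOut (c : Fin G.n) (o : Bool) : G.Arc := (G.passage (c, o)).succ

/-- Draw `c` with both strands going upwards.  The strand running from the lower left to the upper
right is the over-strand if `c` is positive and the under-strand if `c` is negative. -/
def rising (c : Fin G.n) : Bool := decide (G.positive c)

/-- Each arc `a` has a left side `(a, true)` and a right side `(a, false)`.  Two sides are adjacent
if they meet in one of the four corners at a crossing (in the order right, top, left, bottom), or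
at the starting point. -/
inductive SideAdj : G.Arc × Bool → G.Arc × Bool → Prop
  | right (c : Fin G.n) :
      SideAdj (G.arcIn c (!G.rising c), false) (G.arcOut c (G.rising c), false)
  | top (c : Fin G.n) :
      SideAdj (G.arcOut c (G.rising c), true) (G.arcOut c (!G.rising c), false)
  | left (c : Fin G.n) :
      SideAdj (G.arcOut c (!G.rising c), true) (G.arcIn c (G.rising c), true)
  | bottom (c : Fin G.n) :
      SideAdj (G.arcIn c (G.rising c), false) (G.arcIn c (!G.rising c), true)
  | start (l : Bool) : SideAdj (Fin.last (2 * G.n), l) (0, l)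

/-- The faces of the diagram on the closed oriented surface that the code determines. -/
abbrev Face : Type := Quot G.SideAdj

/-- The surface has Euler characteristic `2`, i.e. it is the sphere: there are `n + 1` vertices
(the crossings and the starting point), `2n + 1` edges, and the faces. -/
def Planar : Prop := ((G.n : ℤ) + 1) - (2 * G.n + 1) + Nat.card G.Face = 2

end SignedGaussCode

/-- A knot diagram (on the sphere, up to isotopy): a planar signed Gauss code. -/
structure KnotDiagram extends SignedGaussCode where
  planar : toSignedGaussCode.Planar

/-! ## Smoothings and circles -/

namespace KnotDiagram

variable (D : KnotDiagram)

/-- The arcs of the diagram. -/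
abbrev Arc : Type := D.toSignedGaussCode.Arc

/-- A smoothing: a vertex of the cube, choosing the `0`-smoothing (`false`) or the `1`-smoothing
(`true`) at every crossing. -/
abbrev Smoothing : Type := Fin D.n → Bool

/-- The smoothing `S` is compatible with the orientation of the knot at `c`: this is the
`0`-smoothing at a positive and the `1`-smoothing at a negative crossing. -/
def OrientedAt (S : D.Smoothing) (c : Fin D.n) : Prop := S c = false ↔ D.positive c

/-- The arcs that are joined to each other in the smoothing `S`, at the crossings and at the
starting point of the traversal. -/
inductive Join (S : D.Smoothing) : D.Arc → D.Arc → Prop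
  | oriented (c : Fin D.n) (o : Bool) (h : D.OrientedAt S c) :
      Join S (D.arcIn c o) (D.arcOut c (!o))
  | unorientedIn (c : Fin D.n) (h : ¬ D.OrientedAt S c) :
      Join S (D.arcIn c true) (D.arcIn c false)
  | unorientedOut (c : Fin D.n) (h : ¬ D.OrientedAt S c) :
      Join S (D.arcOut c true) (D.arcOut c false)
  | start : Join S (Fin.last (2 * D.n)) 0

/-- The circles of the smoothing `S`. -/
abbrev Circle (S : D.Smoothing) : Type := Quot (D.Join S)

/-- The circle of `S` containing the arc `a`. -/
abbrev circle (S : D.Smoothing) (a : D.Arc) : D.Circle S := Quot.mk _ a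

instance (S : D.Smoothing) : Fintype (D.Circle S) := Fintype.ofFinite _

/-! ## The Bar-Natan complex

The summand of a smoothing `S` is the tensor power of `A = R[x]/(x² - x)` over the circles of `S`.
We use the basis of tensors of `1` and `x`, recorded as labellings of the circles,
`false` for `1` and `true` for `x`. -/

/-- A standard generator: a smoothing with a label `1` (`false`) or `x` (`true`) on each circle. -/
@[ext] structure Generator where
  smoothing : D.Smoothing
  label : D.Circle smoothing → Bool

instance : Finite D.Generator :=
  Finite.of_injective
    (fun s => (⟨s.smoothing, s.label⟩ : Σ S : D.Smoothing, D.Circle S → Bool))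
    (fun s t h => by cases s; cases t; simpa using h)

/-- The number of `1`-smoothings. -/
def height (S : D.Smoothing) : ℕ := Nat.card {c : Fin D.n // S c = true}

/-- The number of positive crossings. -/
def nPos : ℕ := Nat.card {c : Fin D.n // D.positive c}

/-- The number of negative crossings. -/
def nNeg : ℕ := Nat.card {c : Fin D.n // ¬ D.positive c}

/-- The homological degree. -/
def homDegree (s : D.Generator) : ℤ := D.height s.smoothing - D.nNeg

/-- The quantum degree; the label `1` has degree `1` and the label `x` has degree `-1`. -/
def qDegree (s : D.Generator) : ℤ :=
  (∑ k : D.Circle s.smoothing, if s.label k then (-1 : ℤ) else 1)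
    + D.height s.smoothing + D.nPos - 2 * D.nNeg

/-- The standard generators of homological degree `i`. -/
abbrev GeneratorIn (i : ℤ) : Type := {s : D.Generator // D.homDegree s = i}

instance (i : ℤ) : Fintype (D.GeneratorIn i) := Fintype.ofFinite _

/-- The cochain group in homological degree `i`, with coefficients in `R`. -/
abbrev Cochain (R : Type*) [CommRing R] (i : ℤ) : Type _ := D.GeneratorIn i →₀ R

/-- The coefficient of `c` in the product `a b` of `A`, where `a, b, c ∈ {1, x}`:
`1·1 = 1`, `1·x = x·1 = x·x = x`. -/
def mulCoeff (a b c : Bool) : ℤ := if c = (a || b) then 1 else 0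

/-- The coefficient of `b ⊗ c` in `Δ(a)`, where `a, b, c ∈ {1, x}`:
`Δ(1) = 1 ⊗ x + x ⊗ 1 - 1 ⊗ 1`, `Δ(x) = x ⊗ x`. -/
def comulCoeff : Bool → Bool → Bool → ℤ
  | false, false, true => 1
  | false, true, false => 1
  | false, false, false => -1
  | true, true, true => 1
  | _, _, _ => 0

/-- The coefficient of `t` in the image of `s` under the edge map at the crossing `c`, for `s` with
the `0`-smoothing at `c` and `t` with the same smoothing as `s` except at `c`.  In either smoothing
the two strands at `c` contain the incoming and the outgoing under-arc, respectively.  The edge map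
is the identity on the factors of the circles that avoid `c`, and multiplication or
comultiplication on the others. -/
def edgeCoeff (c : Fin D.n) (s t : D.Generator) : ℤ :=
  let S := s.smoothing
  let T := t.smoothing
  let a := D.arcIn c false
  let b := D.arcOut c false
  if ∀ e : D.Arc, D.circle S e ≠ D.circle S a → D.circle S e ≠ D.circle S b →
      s.label (D.circle S e) = t.label (D.circle T e) then
    if D.circle S a ≠ D.circle S b ∧ D.circle T a = D.circle T b then
      mulCoeff (s.label (D.circle S a)) (s.label (D.circle S b)) (t.label (D.circle T a))
    else if D.circle S a = D.circle S b ∧ D.circle T a ≠ D.circle T b then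
      comulCoeff (s.label (D.circle S a)) (t.label (D.circle T a)) (t.label (D.circle T b))
    else 0
  else 0

/-- The coefficient of `t` in the differential of `s`: the sum of the edge maps with the usual
signs. -/
def diffCoeff (s t : D.Generator) : ℤ :=
  ∑ c : Fin D.n,
    if s.smoothing c = false ∧ t.smoothing = Function.update s.smoothing c true then
      (-1) ^ Nat.card {c' : Fin D.n // c' < c ∧ s.smoothing c' = true} * D.edgeCoeff c s t
    else 0

/-- The Bar-Natan differential (it vanishes unless `j = i + 1`). -/
def d (R : Type*) [CommRing R] (i j : ℤ) : D.Cochain R i →ₗ[R] D.Cochain R j :=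
  Finsupp.linearCombination R fun s : D.GeneratorIn i =>
    ∑ t : D.GeneratorIn j, Finsupp.single t ((D.diffCoeff s.1 t.1 : ℤ) : R)

/-- The span `F_q` of the standard generators of quantum degree at least `q`. -/
def qSpan (R : Type*) [CommRing R] (q i : ℤ) : Submodule R (D.Cochain R i) :=
  Finsupp.supported R R {s : D.GeneratorIn i | q ≤ D.qDegree s.1}

theorem qSpan_anti (R : Type*) [CommRing R] (q r : ℤ) (h : q ≤ r) (i : ℤ) :
    D.qSpan R r i ≤ D.qSpan R q i :=
  Finsupp.supported_mono fun _ hs => le_trans h hs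

/-- The Bar-Natan complex with its filtration `F_q`. -/
def barNatan (R : Type*) [CommRing R] : Filtration R (D.Cochain R) where
  tot _ := ⊤
  F := D.qSpan R
  le_tot _ _ := le_top
  anti := D.qSpan_anti R

/-! ## The reduced Bar-Natan complex -/

/-- The product of `x`, acting at a base point on the arc `b`, with a standard generator: the label
of the circle through the base point becomes `x`, as `x·1 = x·x = x`. -/
def xGenerator (b : D.Arc) (i : ℤ) (s : D.GeneratorIn i) : D.GeneratorIn i :=
  ⟨⟨s.1.smoothing, Function.update s.1.label (D.circle s.1.smoothing b) true⟩, s.2⟩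

/-- The action of `x ∈ A` on the cochain groups given by a base point on the arc `b`. -/
def xAction (R : Type*) [CommRing R] (b : D.Arc) (i : ℤ) : D.Cochain R i →ₗ[R] D.Cochain R i :=
  Finsupp.lmapDomain R R (D.xGenerator b i)

/-- The reduced Bar-Natan complex `x C` with its filtration `x F_{q+1}` in degree `q`. -/
def reducedBarNatan (R : Type*) [CommRing R] (b : D.Arc) : Filtration R (D.Cochain R) where
  tot i := LinearMap.range (D.xAction R b i)
  F q i := (D.qSpan R (q + 1) i).map (D.xAction R b i)
  le_tot _ _ := LinearMap.map_le_range
  anti q r h i := Submodule.map_mono (D.qSpan_anti R (q + 1) (r + 1) (by omega) i)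

end KnotDiagram

end

/-! ### Filtered complexes: transfer of graded torsion along an involution -/

section Cohomology

variable {R : Type*} [CommRing R] {C : ℤ → Type*} [∀ i, AddCommGroup (C i)] [∀ i, Module R (C i)]

/-! The algebra A is the ring of functions on the two points x = 0 and x = 1, so a cochain is
determined by its values at two-colourings of the circles (`ext_eval`). In these coordinates every
edge map is diagonal (`sum_edgeCoeff_mul_evalGenerator`): a merge has weight 1, a split has weight 1
or -1 according to the colour. Exchanging the colours, i.e. x and 1 - x, thus commutes with the edge
maps up to a sign at splits, which a sign on each smoothing absorbs. The result is a chain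
involution J (`conjugation`) with J x J = 1 - x. As 1 - x has lowest term -x, J preserves the
filtration and acts on successive graded pieces by alternating signs, normalised to +1 in degree q.

The rest is filtered algebra (`gradedTorsionFreeAt_iff_of_involution`). Since x J x = 0, the map ρ =
x(J + 1) is a chain retraction onto the reduced complex. Multiplication by x costs two quantum
degrees, but J + 1 gains two on F_{q+2}, so ρ preserves F_{q+2}. Applying ρ carries torsion freeness
from the unreduced to the reduced complex.

Conversely, let z in F_q be a cocycle with pz in F_{q+2} up to coboundaries. The reduced hypothesis
in degree q - 1, applied to xJz, replaces z modulo F_{q+2} and coboundaries by a reduced cocycle w;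
then ρ moves the relation for pw into the reduced complex, and the hypothesis in degree q + 1
disposes of w. Nothing is divided by 2, so p = 2 needs no separate treatment. -/

theorem mem_inducedFiltration_mk (d : ∀ i j, C i →ₗ[R] C j) (𝓕 : Filtration R C) (q i : ℤ)
    (z : cocycles d 𝓕.tot i) :
    (Submodule.Quotient.mk z : Cohomology d 𝓕.tot i) ∈ inducedFiltration d 𝓕 q i ↔
      ∃ z' ∈ cocycles d (𝓕.F q) i, ∃ b ∈ 𝓕.tot (i - 1), (z : C i) = z' + d (i - 1) i b := by
  constructor
  · rintro ⟨y, hy⟩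
    obtain ⟨y, rfl⟩ := Submodule.Quotient.mk_surjective _ y
    have hy' := (Submodule.Quotient.eq _).1 hy.symm
    obtain ⟨b, hb, hb'⟩ := hy'
    refine ⟨y, y.2, b, hb, ?_⟩
    rw [hb']
    simp
  · rintro ⟨z', hz', b, hb, h⟩
    refine ⟨Submodule.Quotient.mk ⟨z', hz'⟩, ?_⟩
    refine ((Submodule.Quotient.eq _).2 ?_).symm
    refine ⟨b, hb, ?_⟩
    simp [h]

/-- Graded `p`-torsion freeness in terms of cochains. -/
theorem gradedTorsionFreeAt_iff {p : ℕ} (hp : p.Prime) (d : ∀ i j, C i →ₗ[R] C j)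
    (𝓕 : Filtration R C) :
    GradedTorsionFreeAt p d 𝓕 ↔ ∀ q i : ℤ, ∀ z ∈ cocycles d (𝓕.F q) i,
      (∃ z' ∈ cocycles d (𝓕.F (q + 2)) i, ∃ b ∈ 𝓕.tot (i - 1), p • z = z' + d (i - 1) i b) →
      ∃ z' ∈ cocycles d (𝓕.F (q + 2)) i, ∃ b ∈ 𝓕.tot (i - 1), z = z' + d (i - 1) i b := by
  have : Fact p.Prime := ⟨hp⟩
  refine forall_congr' fun q => forall_congr' fun i => ⟨fun h z hz hpz => ?_, fun h a ha => ?_⟩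
  · let z₀ : cocycles d 𝓕.tot i := ⟨z, cocycles_mono d (𝓕.le_tot q) i hz⟩
    have hz₀ : (Submodule.Quotient.mk z₀ : Cohomology d 𝓕.tot i) ∈ inducedFiltration d 𝓕 q i :=
      (mem_inducedFiltration_mk d 𝓕 q i z₀).2 ⟨z, hz, 0, zero_mem _, by simp [z₀]⟩
    -- As p is prime, order p means nonzero and killed by p.
    by_contra hcon
    refine h (Submodule.Quotient.mk ⟨_, hz₀⟩) (addOrderOf_eq_prime ?_ ?_)
    · rw [← Submodule.Quotient.mk_smul, Submodule.Quotient.mk_eq_zero]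
      exact (mem_inducedFiltration_mk d 𝓕 (q + 2) i (p • z₀)).2 hpz
    · rw [Ne, Submodule.Quotient.mk_eq_zero]
      exact fun h' => hcon ((mem_inducedFiltration_mk d 𝓕 (q + 2) i z₀).1 h')
  · obtain ⟨hpa, ha⟩ := addOrderOf_eq_prime_iff.1 ha
    obtain ⟨⟨a, haq⟩, rfl⟩ := Submodule.Quotient.mk_surjective _ a
    obtain ⟨y, rfl⟩ := haq
    obtain ⟨⟨z, hz⟩, rfl⟩ := Submodule.Quotient.mk_surjective _ y
    let z₀ : cocycles d 𝓕.tot i := ⟨z, cocycles_mono d (𝓕.le_tot q) i hz⟩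
    rw [← Submodule.Quotient.mk_smul, Submodule.Quotient.mk_eq_zero] at hpa
    rw [Ne, Submodule.Quotient.mk_eq_zero] at ha
    exact ha ((mem_inducedFiltration_mk d 𝓕 (q + 2) i z₀).2
      (h z hz ((mem_inducedFiltration_mk d 𝓕 (q + 2) i (p • z₀)).1 hpa)))

theorem map_mem_cocycles {d : ∀ i j, C i →ₗ[R] C j} {U V : ∀ i, Submodule R (C i)} {i : ℤ}
    (f : ∀ i, C i →ₗ[R] C i) (hf : ∀ i a, f (i + 1) (d i (i + 1) a) = d i (i + 1) (f i a))
    (hUV : ∀ a ∈ U i, f i a ∈ V i) {z : C i} (hz : z ∈ cocycles d U i) :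
    f i z ∈ cocycles d V i := by
  refine ⟨hUV z hz.1, ?_⟩
  have := hz.2
  rw [SetLike.mem_coe, LinearMap.mem_ker] at this ⊢
  rw [← hf, this, map_zero]

/-- Let `x` be an idempotent chain map which lowers a filtration `𝓕` by at most `2`, and suppose
that there are chain involutions `J` conjugating `x` to `1 - x` that act on consecutive graded pieces
of `𝓕` by opposite signs.  Then `𝓕` is graded `p`-torsion free if and only if the induced
filtration on the image of `x` is. -/
theorem gradedTorsionFreeAt_iff_of_involution {p : ℕ} (hp : p.Prime) (d : ∀ i j, C i →ₗ[R] C j)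
    (𝓕 𝓖 : Filtration R C) (x : ∀ i, C i →ₗ[R] C i) (J : ℤ → ∀ i, C i →ₗ[R] C i)
    (htot : ∀ i, 𝓕.tot i = ⊤) (htot' : ∀ i, 𝓖.tot i = LinearMap.range (x i))
    (hF : ∀ q i, 𝓖.F q i = LinearMap.range (x i) ⊓ 𝓕.F (q - 1) i)
    (hxx : ∀ i a, x i (x i a) = x i a)
    (hxd : ∀ i j, j = i + 1 → ∀ a, x j (d i j a) = d i j (x i a))
    (hJd : ∀ q i j, j = i + 1 → ∀ a, J q j (d i j a) = d i j (J q i a))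
    (hJJ : ∀ q i a, J q i (J q i a) = a)
    (hJx : ∀ q i a, J q i (x i (J q i a)) = a - x i a)
    (hx : ∀ q i, ∀ a ∈ 𝓕.F q i, x i a ∈ 𝓕.F (q - 2) i)
    (hJ₁ : ∀ q i, ∀ a ∈ 𝓕.F q i, J q i a - a ∈ 𝓕.F (q + 2) i)
    (hJ₂ : ∀ q i, ∀ a ∈ 𝓕.F (q + 2) i, J q i a + a ∈ 𝓕.F (q + 4) i) :
    GradedTorsionFreeAt p d 𝓖 ↔ GradedTorsionFreeAt p d 𝓕 := by
  have hxJx : ∀ q i a, x i (J q i (x i a)) = 0 := by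
    intro q i a
    -- J x J = 1 - x, evaluated at J x a, reads J x a = J x a - x J x a.
    have h := hJx q i (J q i (x i a))
    rw [hJJ, hxx] at h
    exact sub_eq_self.1 h.symm
  -- A chain retraction onto the image of x. Unlike x itself, it loses no filtration on `𝓕.F (q +
  -- 2)`, because J + 1 gains the 2 that x costs.
  let ρ : ℤ → ∀ i, C i →ₗ[R] C i := fun q i => x i ∘ₗ (J q i + LinearMap.id)
  have hρd : ∀ q i j, j = i + 1 → ∀ a, ρ q j (d i j a) = d i j (ρ q i a) := by
    intro q i j h a
    simp [ρ, hJd q i j h, hxd i j h]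
  have hρx : ∀ q i a, ρ q i (x i a) = x i a := by
    intro q i a
    simp [ρ, hxJx, hxx]
  have hρ : ∀ q i, ∀ a ∈ 𝓕.F (q + 2) i, ρ q i a ∈ LinearMap.range (x i) ⊓ 𝓕.F (q + 2) i := by
    intro q i a ha
    refine ⟨⟨_, rfl⟩, ?_⟩
    have := hx _ i _ (hJ₂ q i a ha)
    rwa [show q + 4 - 2 = q + 2 by ring] at this
  have hG : ∀ q i, 𝓖.F (q + 1) i = LinearMap.range (x i) ⊓ 𝓕.F q i := by
    intro q i
    rw [hF, add_sub_cancel_right]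
  have hi : ∀ i : ℤ, i = i - 1 + 1 := fun i => by ring
  rw [gradedTorsionFreeAt_iff hp, gradedTorsionFreeAt_iff hp]
  have hle : ∀ r i, 𝓖.F (r + 1) i ≤ 𝓕.F r i := fun r i => (hG r i).le.trans inf_le_right
  refine ⟨fun h q i z hz hpz => ?_, fun h q i z hz hpz => ?_⟩
  · obtain ⟨z', hz', b, -, hpz⟩ := hpz
    have hJF : ∀ a ∈ 𝓕.F q i, J q i a ∈ 𝓕.F q i := fun a ha => by
      have := add_mem (𝓕.anti _ _ (show q ≤ q + 2 by omega) i (hJ₁ q i a ha)) ha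
      rwa [sub_add_cancel] at this
    have hJF' : ∀ a ∈ 𝓕.F (q + 2) i, J q i a ∈ 𝓕.F (q + 2) i := fun a ha => by
      have := sub_mem (𝓕.anti _ _ (show q + 2 ≤ q + 4 by omega) i (hJ₂ q i a ha)) ha
      rwa [add_sub_cancel_right] at this
    have hxJd : ∀ i j, j = i + 1 → ∀ a, (x j ∘ₗ J q j) (d i j a) = d i j ((x i ∘ₗ J q i) a) := by
      intro i j h a
      simp [hJd q i j h, hxd i j h]
    -- First use of the hypothesis, in reduced degree q - 1: xJz and xJz' lie in the image of x, in
    -- filtrations q - 2 and q.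
    have hu : (x i ∘ₗ J q i) z ∈ cocycles d (𝓖.F (q - 1)) i := by
      refine map_mem_cocycles (fun i => x i ∘ₗ J q i) (fun i => hxJd i _ rfl) (fun a ha => ?_) hz
      rw [show q - 1 = q - 2 + 1 by ring, hG]
      exact ⟨⟨_, rfl⟩, hx _ _ _ (hJF a ha)⟩
    have hu' : (x i ∘ₗ J q i) z' ∈ cocycles d (𝓖.F (q - 1 + 2)) i := by
      refine map_mem_cocycles (fun i => x i ∘ₗ J q i) (fun i => hxJd i _ rfl) (fun a ha => ?_) hz'
      rw [show q - 1 + 2 = q + 2 - 2 + 1 by ring, hG]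
      exact ⟨⟨_, rfl⟩, hx _ _ _ (hJF' a ha)⟩
    obtain ⟨v, hv, b₁, hb₁, hzv⟩ := h _ i _ hu ⟨_, hu', (x (i - 1) ∘ₗ J q (i - 1)) b, by
      rw [htot']; exact ⟨_, rfl⟩, by rw [← map_nsmul, hpz, map_add, hxJd _ _ (hi i)]⟩
    rw [show q - 1 + 2 = q + 1 by ring] at hv
    have hs : J q i v - v ∈ cocycles d (𝓕.F (q + 2)) i := by
      refine map_mem_cocycles (fun i => J q i - LinearMap.id) (fun i a => ?_) (hJ₁ q i)
        (cocycles_mono d (hle q) i hv)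
      simp [hJd q i _ rfl]
    -- z - Jz lies in filtration q + 2, so x of it stays in filtration q. The summand 2v is what
    -- makes z - w equal to Jv - v up to a coboundary.
    have hw : x i (z - J q i z) + 2 • v ∈ cocycles d (𝓖.F (q + 1)) i := by
      refine add_mem ?_ (nsmul_mem hv 2)
      refine map_mem_cocycles (fun i => x i ∘ₗ (LinearMap.id - J q i)) (fun i a => ?_)
        (fun a ha => ?_) hz
      · simp [hJd q i _ rfl, hxd i _ rfl]
      · rw [hG]
        refine ⟨⟨_, rfl⟩, ?_⟩
        have := hx _ _ _ (neg_mem (hJ₁ q i a ha))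
        rwa [neg_sub, add_sub_cancel_right] at this
    have hwx : ρ q i (x i (z - J q i z) + 2 • v) = x i (z - J q i z) + 2 • v := by
      obtain ⟨y, hy⟩ := ((hG q i).le hw.1).1
      rw [← hy, hρx]
    generalize hwdef : x i (z - J q i z) + 2 • v = w at hw hwx
    -- Apply J to xJz = v + db₁: this gives z - xz = Jv + dJb₁. Then substitute for xJz in w.
    have hzw : z = w + (J q i v - v) + d (i - 1) i (b₁ + J q (i - 1) b₁) := by
      have h1 := congrArg (J q i) hzv
      rw [LinearMap.comp_apply, hJx, map_add, hJd q _ _ (hi i)] at h1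
      rw [LinearMap.comp_apply] at hzv
      rw [← hwdef, map_add, map_sub, hzv]
      rw [sub_eq_iff_eq_add] at h1
      nth_rw 1 [h1]
      module
    have hpw : p • w = (z' - p • (J q i v - v)) +
        d (i - 1) i (b - p • (b₁ + J q (i - 1) b₁)) := by
      have h1 : p • w = p • z - p • (J q i v - v) - p • d (i - 1) i (b₁ + J q (i - 1) b₁) := by
        nth_rw 1 [hzw]
        simp only [smul_add]
        abel
      rw [h1, hpz, map_sub, map_nsmul]
      abel
    -- Second use of the hypothesis, in degree q + 1. The relation for pw involves unreduced
    -- cochains; ρ fixes w and pushes the other terms into the reduced complex without filtration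
    -- loss.
    obtain ⟨w', hw', b₂, -, hww'⟩ := h (q + 1) i w hw
      ⟨ρ q i (z' - p • (J q i v - v)), by
        refine map_mem_cocycles (ρ q) (fun i => hρd q i _ rfl) (fun a ha => ?_)
          (sub_mem hz' (nsmul_mem hs p))
        rw [show q + 1 + 2 = q + 2 + 1 by ring, hG]
        exact hρ q i a ha, ρ q (i - 1) (b - p • (b₁ + J q (i - 1) b₁)), by
        rw [htot']; exact ⟨_, rfl⟩, by
        rw [← hρd q _ _ (hi i), ← map_add, ← hpw, map_nsmul, hwx]⟩
    rw [show q + 1 + 2 = q + 2 + 1 by ring] at hw'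
    refine ⟨w' + (J q i v - v), add_mem (cocycles_mono d (hle (q + 2)) i hw') hs,
      b₂ + (b₁ + J q (i - 1) b₁), by simp [htot], ?_⟩
    rw [map_add, hzw, hww']
    abel
  · obtain ⟨z', hz', b, -, hpz⟩ := hpz
    obtain ⟨r, rfl⟩ : ∃ r, q = r + 1 := ⟨q - 1, by ring⟩
    rw [show r + 1 + 2 = r + 2 + 1 by ring] at hz' ⊢
    obtain ⟨w, hw, c, -, hzw⟩ := h r i z (cocycles_mono d (hle r) i hz)
      ⟨z', cocycles_mono d (hle (r + 2)) i hz', b, by simp [htot], hpz⟩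
    -- The unreduced decomposition z = w + dc is retracted by ρ, which fixes z.
    refine ⟨ρ r i w, map_mem_cocycles (ρ r) (fun i => hρd r i _ rfl) ?_ hw, ρ r (i - 1) c, ?_, ?_⟩
    · intro a ha
      rw [hG]
      exact hρ r i a ha
    · rw [htot']
      exact ⟨_, rfl⟩
    · have hzx : z ∈ LinearMap.range (x i) := ((hG r i).le hz.1).1
      obtain ⟨y, rfl⟩ := hzx
      rw [← hρx r, hzw, map_add, hρd r _ _ (hi i)]

end Cohomology

noncomputable section

open scoped Classical

/-! ## Changing a relation near two points -/

section Quot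

variable {α : Type*} {r r' : α → α → Prop} {a b : α}

/-- The point `e` is identified with one of `a` and `b` in the quotient by `r`. -/
def NearPair (r : α → α → Prop) (a b e : α) : Prop :=
  Quot.mk r e = Quot.mk r a ∨ Quot.mk r e = Quot.mk r b

theorem nearPair_congr {e f : α} (h : Quot.mk r e = Quot.mk r f) :
    NearPair r a b e ↔ NearPair r a b f := by
  rw [NearPair, NearPair, h]

/-- The relation `r` only identifies points that `r'` identifies or that are near `a` and `b`. -/
def RefinesOffPair (r r' : α → α → Prop) (a b : α) : Prop :=
  ∀ e f, r e f → Quot.mk r' e = Quot.mk r' f ∨ (NearPair r' a b e ∧ NearPair r' a b f)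

/-- Nearness to the pair is invariant under `r'`, so in a chain of elementary identifications a
single step near the pair makes both ends near. -/
theorem RefinesOffPair.of_mk_eq (h : RefinesOffPair r r' a b) {e f : α}
    (hef : Quot.mk r e = Quot.mk r f) :
    Quot.mk r' e = Quot.mk r' f ∨ (NearPair r' a b e ∧ NearPair r' a b f) := by
  have := Quot.eqvGen_exact hef
  clear hef
  induction this with
  | rel e f hef => exact h e f hef
  | refl e => exact Or.inl rfl
  | symm e f _ ih => exact ih.imp Eq.symm And.symm
  | trans e f g _ _ ih₁ ih₂ =>
    rcases ih₁ with h₁ | h₁ <;> rcases ih₂ with h₂ | h₂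
    · exact Or.inl (h₁.trans h₂)
    · exact Or.inr ⟨(nearPair_congr h₁).2 h₂.1, h₂.2⟩
    · exact Or.inr ⟨h₁.1, (nearPair_congr h₂).1 h₁.2⟩
    · exact Or.inr ⟨h₁.1, h₂.2⟩

theorem RefinesOffPair.nearPair (h : RefinesOffPair r r' a b) {e : α} (he : NearPair r a b e) :
    NearPair r' a b e := by
  rcases he with he | he
  · exact (h.of_mk_eq he).elim Or.inl And.left
  · exact (h.of_mk_eq he).elim Or.inr And.left

theorem RefinesOffPair.mk_eq (h : RefinesOffPair r r' a b) {e f : α} (he : ¬ NearPair r' a b e)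
    (hef : Quot.mk r e = Quot.mk r f) : Quot.mk r' e = Quot.mk r' f :=
  (h.of_mk_eq hef).resolve_right fun h' => he h'.1

/-- Sending a class of `r` to the `r'`-class of a representative is injective off the pair, since
there `r'` identifies no more than `r` does. -/
theorem RefinesOffPair.card_le [Finite α] (h : RefinesOffPair r' r a b) :
    ({Quot.mk r a, Quot.mk r b}ᶜ : Set (Quot r)).ncard ≤
      ({Quot.mk r' a, Quot.mk r' b}ᶜ : Set (Quot r')).ncard := by
  have key : ∀ (s : α → α → Prop) (e : α),
      Quot.mk s e ∈ ({Quot.mk s a, Quot.mk s b}ᶜ : Set (Quot s)) ↔ ¬ NearPair s a b e := by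
    intro s e
    simp [NearPair]
  refine Set.ncard_le_ncard_of_injOn (fun k => Quot.mk r' k.out) ?_ ?_ (Set.toFinite _)
  · intro k hk
    rw [← Quot.out_eq k, key] at hk
    exact (key _ _).2 fun hn => hk (h.nearPair hn)
  · intro k hk l hl hkl
    rw [← Quot.out_eq k, key] at hk
    have := h.mk_eq hk hkl
    rwa [Quot.out_eq, Quot.out_eq] at this

/-- The classes off the pair are equinumerous; the pair itself contributes two classes on one side
and one on the other. Thus a merge or split changes the number of circles by one. -/
theorem RefinesOffPair.card_quot [Finite α] (h : RefinesOffPair r r' a b)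
    (h' : RefinesOffPair r' r a b) (hr : Quot.mk r a ≠ Quot.mk r b)
    (hr' : Quot.mk r' a = Quot.mk r' b) : Nat.card (Quot r) = Nat.card (Quot r') + 1 := by
  have h₁ := Set.ncard_add_ncard_compl ({Quot.mk r a, Quot.mk r b} : Set (Quot r))
  have h₂ := Set.ncard_add_ncard_compl ({Quot.mk r' a, Quot.mk r' b} : Set (Quot r'))
  rw [Set.ncard_pair hr] at h₁
  rw [← hr', Set.pair_eq_singleton, Set.ncard_singleton] at h₂
  have h₃ := h'.card_le.antisymm h.card_le
  rw [← hr', Set.pair_eq_singleton] at h₃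
  omega

end Quot

/-! ## The edges of the cube -/

namespace KnotDiagram

variable (D : KnotDiagram)

/-- Either smoothing joins each end of the over-strand to an end of the under-strand, so the two
under-arcs meet every circle at the crossing. -/
theorem nearPair_arc (S : D.Smoothing) (c : Fin D.n) (o : Bool) :
    NearPair (D.Join S) (D.arcIn c false) (D.arcOut c false) (D.arcIn c o) ∧
      NearPair (D.Join S) (D.arcIn c false) (D.arcOut c false) (D.arcOut c o) := by
  cases o
  · exact ⟨Or.inl rfl, Or.inr rfl⟩
  · by_cases h : D.OrientedAt S c
    · exact ⟨Or.inr (Quot.sound (Join.oriented c true h)),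
        Or.inl (Quot.sound (Join.oriented c false h)).symm⟩
    · exact ⟨Or.inl (Quot.sound (Join.unorientedIn c h)),
        Or.inr (Quot.sound (Join.unorientedOut c h))⟩

theorem refinesOffPair_join {S T : D.Smoothing} {c : Fin D.n} (h : ∀ c', c' ≠ c → S c' = T c') :
    RefinesOffPair (D.Join S) (D.Join T) (D.arcIn c false) (D.arcOut c false) := by
  have hor : ∀ c', c' ≠ c → (D.OrientedAt S c' ↔ D.OrientedAt T c') := by
    intro c' hc'
    rw [OrientedAt, OrientedAt, h c' hc']
  intro e f hef
  cases hef with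
  | oriented c' o ho =>
    by_cases hc : c' = c
    · subst hc
      exact Or.inr ⟨(D.nearPair_arc T c' o).1, (D.nearPair_arc T c' (!o)).2⟩
    · exact Or.inl (Quot.sound (Join.oriented c' o ((hor c' hc).1 ho)))
  | unorientedIn c' ho =>
    by_cases hc : c' = c
    · subst hc
      exact Or.inr ⟨(D.nearPair_arc T c' _).1, (D.nearPair_arc T c' _).1⟩
    · exact Or.inl (Quot.sound (Join.unorientedIn c' (mt (hor c' hc).2 ho)))
  | unorientedOut c' ho =>
    by_cases hc : c' = c
    · subst hc
      exact Or.inr ⟨(D.nearPair_arc T c' _).2, (D.nearPair_arc T c' _).2⟩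
    · exact Or.inl (Quot.sound (Join.unorientedOut c' (mt (hor c' hc).2 ho)))
  | start => exact Or.inl (Quot.sound Join.start)

theorem height_update {S : D.Smoothing} {c : Fin D.n} (h : S c = false) :
    D.height (Function.update S c true) = D.height S + 1 := by
  have key : ∀ S : D.Smoothing, D.height S = {c | S c = true}.ncard := fun _ => rfl
  rw [key, key, ← Set.ncard_insert_of_notMem (a := c) (by simp [h]) (Set.toFinite _)]
  congr 1
  ext c'
  by_cases hc : c' = c
  · simp [hc]
  · simp [hc]

/-! ## Evaluation of cochains at colourings

As `A` is the ring of functions on `{x = 0, x = 1}` with values in the coefficients, a cochain can be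
evaluated at the colourings of the circles of a smoothing by two colours.  Such a colouring is
viewed as a function on the set of arcs. -/

/-- The colouring `κ` of the arcs is constant on the circles of `S`. -/
def Compatible (S : D.Smoothing) (κ : D.Arc → Bool) : Prop :=
  ∀ e f, D.Join S e f → κ e = κ f

variable {D} in
theorem Compatible.eq {S : D.Smoothing} {κ : D.Arc → Bool} (h : D.Compatible S κ) {e f : D.Arc}
    (hef : D.circle S e = D.circle S f) : κ e = κ f :=
  congrArg (Quot.lift κ h) hef

variable {D} in
theorem Compatible.not {S : D.Smoothing} {κ : D.Arc → Bool} (h : D.Compatible S κ) :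
    D.Compatible S fun e => !κ e :=
  fun e f hef => congrArg _ (h e f hef)

/-- The value at the colouring `κ` of the smoothing `S` of the function that the standard generator
`s` represents. -/
def evalGenerator (S : D.Smoothing) (κ : D.Arc → Bool) (s : D.Generator) : ℤ :=
  if s.smoothing = S ∧ D.Compatible S κ ∧
    ∀ e, s.label (D.circle s.smoothing e) = true → κ e = true then 1 else 0

/-- The factor at the colouring `κ` of the edge map from `S` to `T` at the crossing `c`. -/
def edgeWeight (c : Fin D.n) (S T : D.Smoothing) (κ : D.Arc → Bool) : ℤ :=
  let a := D.arcIn c false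
  let b := D.arcOut c false
  if D.circle S a ≠ D.circle S b ∧ D.circle T a = D.circle T b then 1
  else if D.circle S a = D.circle S b ∧ D.circle T a ≠ D.circle T b then
    if κ a then 1 else -1
  else 0

/-- The joins of `S` that may fail in `T` are between arcs near `c`, and these all have one colour
by `hab`. -/
theorem compatible_of_edge {S T : D.Smoothing} {c : Fin D.n} (h : ∀ c', c' ≠ c → S c' = T c')
    {κ : D.Arc → Bool} (hκ : D.Compatible T κ) (hab : κ (D.arcIn c false) = κ (D.arcOut c false)) :
    D.Compatible S κ := by
  intro e f hef
  rcases D.refinesOffPair_join h e f hef with h' | ⟨h₁, h₂⟩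
  · exact hκ.eq h'
  · have : ∀ g, NearPair (D.Join T) (D.arcIn c false) (D.arcOut c false) g →
        κ g = κ (D.arcIn c false) := fun g hg =>
      hg.elim hκ.eq fun hg => (hκ.eq hg).trans hab.symm
    rw [this e h₁, this f h₂]

/-! ### Generators on the two sides of an edge -/

theorem label_le_iff {κ : D.Arc → Bool} (s : D.Generator) (c : Fin D.n)
    (hκ : D.Compatible s.smoothing κ) :
    (∀ e, s.label (D.circle s.smoothing e) = true → κ e = true) ↔
      (∀ e, ¬ NearPair (D.Join s.smoothing) (D.arcIn c false) (D.arcOut c false) e →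
        s.label (D.circle s.smoothing e) = true → κ e = true) ∧
      (s.label (D.circle s.smoothing (D.arcIn c false)) = true → κ (D.arcIn c false) = true) ∧
      (s.label (D.circle s.smoothing (D.arcOut c false)) = true →
        κ (D.arcOut c false) = true) := by
  refine ⟨fun h => ⟨fun e _ => h e, h _, h _⟩, fun ⟨h₁, h₂, h₃⟩ e => ?_⟩
  by_cases he : NearPair (D.Join s.smoothing) (D.arcIn c false) (D.arcOut c false) e
  · rcases he with he | he
    · rw [hκ.eq he, show D.circle s.smoothing e = _ from he]
      exact h₂
    · rw [hκ.eq he, show D.circle s.smoothing e = _ from he]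
      exact h₃
  · exact h₁ e he

/-- The generator with smoothing `T` that has the labels `α` and `β` at the crossing `c` and the same
labels as `s` on the circles that avoid `c`. -/
def relabel (c : Fin D.n) (T : D.Smoothing) (s : D.Generator) (α β : Bool) : D.Generator where
  smoothing := T
  label k :=
    if k = D.circle T (D.arcIn c false) then α
    else if k = D.circle T (D.arcOut c false) then β
    else s.label (D.circle s.smoothing k.out)

theorem relabel_label_of_not_near {c : Fin D.n} {T : D.Smoothing} {s : D.Generator}
    (h : ∀ c', c' ≠ c → s.smoothing c' = T c') (α β : Bool) {e : D.Arc}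
    (he : ¬ NearPair (D.Join T) (D.arcIn c false) (D.arcOut c false) e) :
    (D.relabel c T s α β).label (D.circle T e) = s.label (D.circle s.smoothing e) := by
  have h' := D.refinesOffPair_join h
  have h'' := D.refinesOffPair_join fun c' hc' => (h c' hc').symm
  have h₁ : D.circle T e ≠ D.circle T (D.arcIn c false) := fun h => he (Or.inl h)
  have h₂ : D.circle T e ≠ D.circle T (D.arcOut c false) := fun h => he (Or.inr h)
  -- The representative chosen by `relabel` need not be `e`, but away from `c` it lies on the same
  -- circle of the source smoothing.
  have h₃ : D.circle s.smoothing e = D.circle s.smoothing (D.circle T e).out :=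
    h''.mk_eq (fun hn => he (h'.nearPair hn)) (Quot.out_eq _).symm
  simp only [relabel, if_neg h₁, if_neg h₂]
  rw [h₃]

theorem eq_relabel {c : Fin D.n} {s t : D.Generator}
    (h : ∀ c', c' ≠ c → s.smoothing c' = t.smoothing c')
    (hst : ∀ e, D.circle s.smoothing e ≠ D.circle s.smoothing (D.arcIn c false) →
      D.circle s.smoothing e ≠ D.circle s.smoothing (D.arcOut c false) →
      s.label (D.circle s.smoothing e) = t.label (D.circle t.smoothing e)) :
    t = D.relabel c t.smoothing s (t.label (D.circle t.smoothing (D.arcIn c false)))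
      (t.label (D.circle t.smoothing (D.arcOut c false))) := by
  have h' := D.refinesOffPair_join h
  refine Generator.ext rfl (heq_of_eq (funext fun k => ?_))
  induction k using Quot.ind with
  | mk e =>
    by_cases he : NearPair (D.Join t.smoothing) (D.arcIn c false) (D.arcOut c false) e
    · by_cases he' : D.circle t.smoothing e = D.circle t.smoothing (D.arcIn c false)
      · simp [relabel, he']
      · have he'' : D.circle t.smoothing e = D.circle t.smoothing (D.arcOut c false) :=
          he.resolve_left he'
        simp only [relabel, if_neg he', if_pos he'']
        exact congrArg t.label he''
    · refine (hst e ?_ ?_).symm.trans (D.relabel_label_of_not_near h _ _ he).symm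
      · exact fun h'' => he (h'.nearPair (Or.inl h''))
      · exact fun h'' => he (h'.nearPair (Or.inr h''))

theorem relabel_agrees {c : Fin D.n} {T : D.Smoothing} {s : D.Generator}
    (h : ∀ c', c' ≠ c → s.smoothing c' = T c') (α β : Bool) (e : D.Arc)
    (h₁ : D.circle s.smoothing e ≠ D.circle s.smoothing (D.arcIn c false))
    (h₂ : D.circle s.smoothing e ≠ D.circle s.smoothing (D.arcOut c false)) :
    s.label (D.circle s.smoothing e) = (D.relabel c T s α β).label (D.circle T e) :=
  (D.relabel_label_of_not_near h α β fun hn =>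
    ((D.refinesOffPair_join fun c' hc' => (h c' hc').symm).nearPair hn).elim h₁ h₂).symm

/-- The evaluation of a relabelled generator. -/
theorem evalGenerator_relabel {c : Fin D.n} {T : D.Smoothing} {s : D.Generator} {κ : D.Arc → Bool}
    (h : ∀ c', c' ≠ c → s.smoothing c' = T c') (hκ : D.Compatible T κ) (α β : Bool)
    (hαβ : D.circle T (D.arcIn c false) = D.circle T (D.arcOut c false) → α = β) :
    D.evalGenerator T κ (D.relabel c T s α β) =
      if (∀ e, ¬ NearPair (D.Join s.smoothing) (D.arcIn c false) (D.arcOut c false) e →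
          s.label (D.circle s.smoothing e) = true → κ e = true) ∧
        (α = true → κ (D.arcIn c false) = true) ∧ (β = true → κ (D.arcOut c false) = true)
      then 1 else 0 := by
  have h' := D.refinesOffPair_join h
  have h'' := D.refinesOffPair_join fun c' hc' => (h c' hc').symm
  have ha : (D.relabel c T s α β).label (D.circle T (D.arcIn c false)) = α := by simp [relabel]
  have hb : (D.relabel c T s α β).label (D.circle T (D.arcOut c false)) = β := by
    by_cases hT : D.circle T (D.arcIn c false) = D.circle T (D.arcOut c false)
    · rw [← hT, ha, hαβ hT]
    · simp [relabel, Ne.symm hT]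
  rw [evalGenerator]
  refine if_congr ?_ rfl rfl
  have hl := D.label_le_iff (D.relabel c T s α β) c hκ
  refine (and_iff_right rfl).trans ((and_iff_right hκ).trans (hl.trans ?_))
  change (∀ e, ¬ NearPair (D.Join T) _ _ e → (D.relabel c T s α β).label (D.circle T e) = true → _) ∧
    ((D.relabel c T s α β).label (D.circle T _) = true → _) ∧
    ((D.relabel c T s α β).label (D.circle T _) = true → _) ↔ _
  rw [ha, hb]
  refine and_congr_left fun _ => forall_congr' fun e => ?_
  constructor
  · intro hn hne
    have hne' := fun hx => hne (h''.nearPair hx)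
    rw [← D.relabel_label_of_not_near h α β hne']
    exact hn hne'
  · intro hn hne
    rw [D.relabel_label_of_not_near h α β hne]
    exact hn fun hx => hne (h'.nearPair hx)


theorem edgeCoeff_relabel {c : Fin D.n} {T : D.Smoothing} {s : D.Generator}
    (h : ∀ c', c' ≠ c → s.smoothing c' = T c') (α β : Bool)
    (hαβ : D.circle T (D.arcIn c false) = D.circle T (D.arcOut c false) → α = β) :
    D.edgeCoeff c s (D.relabel c T s α β) =
      if D.circle s.smoothing (D.arcIn c false) ≠ D.circle s.smoothing (D.arcOut c false) ∧
          D.circle T (D.arcIn c false) = D.circle T (D.arcOut c false) then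
        mulCoeff (s.label (D.circle s.smoothing (D.arcIn c false)))
          (s.label (D.circle s.smoothing (D.arcOut c false))) α
      else if D.circle s.smoothing (D.arcIn c false) = D.circle s.smoothing (D.arcOut c false) ∧
          D.circle T (D.arcIn c false) ≠ D.circle T (D.arcOut c false) then
        comulCoeff (s.label (D.circle s.smoothing (D.arcIn c false))) α β
      else 0 := by
  have ha : (D.relabel c T s α β).label (D.circle T (D.arcIn c false)) = α := by simp [relabel]
  have hb : (D.relabel c T s α β).label (D.circle T (D.arcOut c false)) = β := by
    by_cases hT : D.circle T (D.arcIn c false) = D.circle T (D.arcOut c false)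
    · rw [← hT, ha, hαβ hT]
    · simp [relabel, Ne.symm hT]
  have hst := D.relabel_agrees h α β
  refine (if_pos hst).trans ?_
  change (if _ ∧ D.circle T _ = D.circle T _ then
    mulCoeff _ _ ((D.relabel c T s α β).label (D.circle T _)) else
    if _ ∧ D.circle T _ ≠ D.circle T _ then comulCoeff _
      ((D.relabel c T s α β).label (D.circle T _)) ((D.relabel c T s α β).label (D.circle T _))
    else 0) = _
  rw [ha, hb]
  exact if_congr Iff.rfl rfl (if_congr Iff.rfl rfl rfl)

/-- With this, the sum over all targets of an edge map collapses to a sum over the labels at the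
crossing. -/
theorem exists_relabel_of_edgeCoeff_ne_zero {c : Fin D.n} {s t : D.Generator}
    (h : ∀ c', c' ≠ c → s.smoothing c' = t.smoothing c') (hst : D.edgeCoeff c s t ≠ 0) :
    ∃ α β, (D.circle t.smoothing (D.arcIn c false) = D.circle t.smoothing (D.arcOut c false) →
      α = β) ∧ t = D.relabel c t.smoothing s α β := by
  refine ⟨_, _, fun hab => ?_, D.eq_relabel h (by_contra fun hn => hst (if_neg hn))⟩
  rw [hab]

theorem relabel_injective {c : Fin D.n} {T : D.Smoothing} {s : D.Generator} {α β α' β' : Bool}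
    (h : D.relabel c T s α β = D.relabel c T s α' β') :
    α = α' ∧ (D.circle T (D.arcIn c false) ≠ D.circle T (D.arcOut c false) → β = β') := by
  have hl : (D.relabel c T s α β).label = (D.relabel c T s α' β').label :=
    eq_of_heq (Generator.mk.inj h).2
  refine ⟨?_, fun hT => ?_⟩
  · simpa [relabel] using congrFun hl (D.circle T (D.arcIn c false))
  · simpa [relabel, Ne.symm hT] using congrFun hl (D.circle T (D.arcOut c false))

/-- In terms of evaluations at colourings, the edge maps are diagonal. -/
theorem sum_edgeCoeff_mul_evalGenerator (c : Fin D.n) (T : D.Smoothing) (s : D.Generator)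
    (h : ∀ c', c' ≠ c → s.smoothing c' = T c') (j : ℤ) (hj : (D.height T : ℤ) - D.nNeg = j)
    (κ : D.Arc → Bool) (hκ : D.Compatible T κ) :
    ∑ t : D.GeneratorIn j, D.edgeCoeff c s t.1 * D.evalGenerator T κ t.1 =
      D.edgeWeight c s.smoothing T κ * D.evalGenerator s.smoothing κ s := by
  set a := D.arcIn c false with ha
  set b := D.arcOut c false with hb
  have hout : ∀ t : D.GeneratorIn j, (∀ α β, (D.circle T a = D.circle T b → α = β) →
      t.1 ≠ D.relabel c T s α β) → D.edgeCoeff c s t.1 * D.evalGenerator T κ t.1 = 0 := by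
    intro t ht
    by_contra hne
    have hT : t.1.smoothing = T := by
      by_contra hT
      exact right_ne_zero_of_mul hne (if_neg fun h => hT h.1)
    subst hT
    obtain ⟨α, β, hαβ, hrel⟩ := D.exists_relabel_of_edgeCoeff_ne_zero h (left_ne_zero_of_mul hne)
    exact ht α β hαβ hrel
  have hs : D.Compatible s.smoothing κ → (D.evalGenerator s.smoothing κ s =
      if (∀ e, ¬ NearPair (D.Join s.smoothing) a b e →
          s.label (D.circle s.smoothing e) = true → κ e = true) ∧
        (s.label (D.circle s.smoothing a) = true → κ a = true) ∧
        (s.label (D.circle s.smoothing b) = true → κ b = true)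
      then 1 else 0) := by
    intro hκs
    rw [evalGenerator]
    exact if_congr ((and_iff_right rfl).trans ((and_iff_right hκs).trans
      (D.label_le_iff s c hκs))) rfl rfl
  by_cases hT : D.circle T a = D.circle T b
  · have hab : κ a = κ b := hκ.eq hT
    rw [hs (D.compatible_of_edge h hκ hab)]
    -- One circle of `T` passes `c`, so a target is determined by a single label.
    rw [← Fintype.sum_of_injective
      (fun α : Bool => (⟨D.relabel c T s α α, hj⟩ : D.GeneratorIn j))
      (fun α β hαβ => (D.relabel_injective (congrArg Subtype.val hαβ)).1)
      (fun α => D.edgeCoeff c s (D.relabel c T s α α) *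
        D.evalGenerator T κ (D.relabel c T s α α)) _ ?_ (fun _ => rfl)]
    · simp only [D.edgeCoeff_relabel h _ _ fun _ => rfl,
        D.evalGenerator_relabel h hκ _ _ fun _ => rfl, edgeWeight, ← ha, ← hb, hT, ← hab]
      by_cases hS : D.circle s.smoothing a = D.circle s.smoothing b
      · simp [hS]
      · simp only [hS]
        cases s.label (D.circle s.smoothing a) <;> cases s.label (D.circle s.smoothing b) <;>
          cases κ a <;> simp [mulCoeff]
    · intro t ht
      refine hout t fun α β hαβ htr => ht ⟨α, Subtype.ext ?_⟩
      rw [htr, hαβ hT]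
  -- Two circles of `T` pass `c`: the targets are indexed by pairs of labels.
  · rw [← Fintype.sum_of_injective
      (fun α : Bool × Bool => (⟨D.relabel c T s α.1 α.2, hj⟩ : D.GeneratorIn j))
      (fun α β hαβ => Prod.ext (D.relabel_injective (congrArg Subtype.val hαβ)).1
        ((D.relabel_injective (congrArg Subtype.val hαβ)).2 hT))
      (fun α => D.edgeCoeff c s (D.relabel c T s α.1 α.2) *
        D.evalGenerator T κ (D.relabel c T s α.1 α.2)) _ ?_ (fun _ => rfl)]
    · simp only [D.edgeCoeff_relabel h _ _ fun h => absurd h hT, Fintype.sum_prod_type,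
        D.evalGenerator_relabel h hκ _ _ fun h => absurd h hT, edgeWeight, ← ha, ← hb]
      by_cases hS : D.circle s.smoothing a = D.circle s.smoothing b
      · by_cases hab : κ a = κ b
        · rw [hs (D.compatible_of_edge h hκ hab)]
          simp only [hS, ← hab]
          cases s.label (D.circle s.smoothing b) <;> cases κ a <;> simp [comulCoeff, hT]
        -- Different colours on the two halves of a split: κ does not descend to the source, and
        -- Δ(1) and Δ(x) both vanish off the diagonal.
        · have : D.evalGenerator s.smoothing κ s = 0 := if_neg fun hc => hab (hc.2.1.eq hS)
          rw [this]
          simp only [hS]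
          revert hab
          cases s.label (D.circle s.smoothing b) <;> cases κ a <;> cases κ b <;>
            simp [comulCoeff, hT]
      · simp [hS, hT]
    · intro t ht
      exact hout t fun α β _ htr => ht ⟨(α, β), Subtype.ext htr.symm⟩

/-! ### The differential in terms of colourings -/

/-- The factor at the colouring `κ` of `T` of the component of the differential at the crossing
`c`. -/
def diffWeight (T : D.Smoothing) (κ : D.Arc → Bool) (c : Fin D.n) : ℤ :=
  if T c = true then
    (-1) ^ Nat.card {c' : Fin D.n // c' < c ∧ T c' = true} *
      D.edgeWeight c (Function.update T c false) T κ
  else 0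

theorem sum_diffCoeff_mul_evalGenerator (T : D.Smoothing) (s : D.Generator) (j : ℤ)
    (hj : j = D.homDegree s + 1) (κ : D.Arc → Bool) (hκ : D.Compatible T κ) :
    ∑ t : D.GeneratorIn j, D.diffCoeff s t.1 * D.evalGenerator T κ t.1 =
      ∑ c, D.diffWeight T κ c * D.evalGenerator (Function.update T c false) κ s := by
  simp only [diffCoeff, Finset.sum_mul]
  rw [Finset.sum_comm]
  refine Finset.sum_congr rfl fun c _ => ?_
  -- For fixed `T` and `c`, the only source smoothing is `T` with `c` switched back to 0.
  by_cases hc : T c = true ∧ s.smoothing = Function.update T c false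
  · obtain ⟨hTc, hS⟩ := hc
    have hsc : s.smoothing c = false := by simp [hS]
    have hT : T = Function.update s.smoothing c true := by
      rw [hS, Function.update_idem, ← hTc, Function.update_eq_self]
    have hoff : ∀ c', c' ≠ c → s.smoothing c' = T c' := fun c' hc' => by simp [hS, hc']
    have hdeg : (D.height T : ℤ) - D.nNeg = j := by
      rw [hj, homDegree, hT, D.height_update hsc]
      push_cast
      ring
    have hcard : Nat.card {c' : Fin D.n // c' < c ∧ s.smoothing c' = true} =
        Nat.card {c' : Fin D.n // c' < c ∧ T c' = true} := by
      refine congrArg (fun P : Fin D.n → Prop => Nat.card (Subtype P)) (funext fun c' => ?_)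
      by_cases hlt : c' < c
      · rw [hoff c' hlt.ne]
      · simp [hlt]
    rw [diffWeight, if_pos hTc, ← hS, mul_assoc,
      ← D.sum_edgeCoeff_mul_evalGenerator c T s hoff j hdeg κ hκ, Finset.mul_sum]
    refine Finset.sum_congr rfl fun t _ => ?_
    by_cases htT : t.1.smoothing = T
    · rw [if_pos ⟨hsc, htT.trans hT⟩, hcard, mul_assoc]
    · rw [show D.evalGenerator T κ t.1 = 0 from if_neg fun h => htT h.1]
      simp
  · have hr : D.diffWeight T κ c * D.evalGenerator (Function.update T c false) κ s = 0 := by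
      by_cases hTc : T c = true
      · rw [show D.evalGenerator (Function.update T c false) κ s = 0 from
          if_neg fun h => hc ⟨hTc, h.1⟩, mul_zero]
      · rw [diffWeight, if_neg hTc, zero_mul]
    rw [hr]
    refine Finset.sum_eq_zero fun t _ => ?_
    by_cases htT : t.1.smoothing = T
    · rw [if_neg, zero_mul]
      rintro ⟨hsc, ht⟩
      rw [htT] at ht
      refine hc ⟨by simp [ht], ?_⟩
      rw [ht, Function.update_idem, ← hsc, Function.update_eq_self]
    · rw [show D.evalGenerator T κ t.1 = 0 from if_neg fun h => htT h.1, mul_zero]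

/-! ### Evaluation of cochains -/

section Eval

variable (R : Type*) [CommRing R]

/-- The value of a cochain at the colouring `κ` of the smoothing `S`. -/
def eval (i : ℤ) (S : D.Smoothing) (κ : D.Arc → Bool) : D.Cochain R i →ₗ[R] R :=
  Finsupp.linearCombination R fun s : D.GeneratorIn i => ((D.evalGenerator S κ s.1 : ℤ) : R)

theorem eval_single (i : ℤ) (S : D.Smoothing) (κ : D.Arc → Bool) (s : D.GeneratorIn i) (r : R) :
    D.eval R i S κ (Finsupp.single s r) = r * (D.evalGenerator S κ s.1 : ℤ) := by
  simp [eval]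

/-- The differential becomes a weighted sum over the incoming edges of the cube, with the colouring
unchanged. Commutation with it is then checked weight by weight. -/
theorem eval_d (i j : ℤ) (hj : j = i + 1) {T : D.Smoothing} {κ : D.Arc → Bool}
    (hκ : D.Compatible T κ) (f : D.Cochain R i) :
    D.eval R j T κ (D.d R i j f) =
      ∑ c, (D.diffWeight T κ c : R) * D.eval R i (Function.update T c false) κ f := by
  induction f using Finsupp.induction_linear with
  | zero => simp
  | add f g hf hg => simp only [map_add, hf, hg, mul_add, Finset.sum_add_distrib]
  | single s r =>
    have h := D.sum_diffCoeff_mul_evalGenerator T s.1 j (by rw [hj, s.2]) κ hκ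
    simp only [d, Finsupp.linearCombination_single, map_smul, map_sum, eval_single]
    have h' := congrArg (Int.cast : ℤ → R) h
    push_cast at h'
    rw [h', smul_eq_mul, Finset.mul_sum]
    exact Finset.sum_congr rfl fun c _ => by ring

/-- A cochain is determined by its values at the colourings. -/
theorem ext_eval {i : ℤ} {f g : D.Cochain R i}
    (h : ∀ S κ, D.Compatible S κ → D.eval R i S κ f = D.eval R i S κ g) : f = g := by
  suffices H : ∀ f : D.Cochain R i, (∀ S κ, D.Compatible S κ → D.eval R i S κ f = 0) → f = 0 from
    sub_eq_zero.1 (H (f - g) fun S κ hκ => by rw [map_sub, h S κ hκ, sub_self])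
  intro f hf
  by_contra hne
  -- Evaluation is triangular: at the colouring given by the labels of `s`, only generators whose
  -- x-circles are among those of `s` survive. Minimality leaves `s` alone, with value 1.
  obtain ⟨s, hs, hmin⟩ := Finset.exists_min_image f.support
    (fun s => (Finset.univ.filter fun k => s.1.label k = true).card)
    (Finsupp.support_nonempty_iff.2 hne)
  let κ : D.Arc → Bool := fun e => s.1.label (D.circle s.1.smoothing e)
  have hκ : D.Compatible s.1.smoothing κ := fun e g heg => congrArg s.1.label (Quot.sound heg)
  have h0 := hf s.1.smoothing κ hκ
  rw [eval, Finsupp.linearCombination_apply, Finsupp.sum, Finset.sum_eq_single s] at h0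
  · have h1 : D.evalGenerator s.1.smoothing κ s.1 = 1 := if_pos ⟨rfl, hκ, fun e he => he⟩
    rw [h1] at h0
    exact Finsupp.mem_support_iff.1 hs (by simpa using h0)
  · intro t ht hts
    suffices h1 : D.evalGenerator s.1.smoothing κ t.1 = 0 by simp [h1]
    refine if_neg fun ⟨h1, h2, h3⟩ => hts ?_
    obtain ⟨⟨S, l⟩, hs'⟩ := s
    obtain ⟨⟨S', l'⟩, ht'⟩ := t
    obtain rfl : S' = S := h1
    have hle : (Finset.univ.filter fun k => l' k = true) ⊆
        Finset.univ.filter fun k => l k = true := by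
      intro k hk
      induction k using Quot.ind with
      | mk e => simpa using h3 e (by simpa using hk)
    have heq := Finset.eq_of_subset_of_card_le hle (hmin _ ht)
    have : l' = l := by
      funext k
      have := Finset.ext_iff.1 heq k
      simp only [Finset.mem_filter, Finset.mem_univ, true_and] at this
      exact Bool.eq_iff_iff.2 this
    subst this
    rfl
  · intro h
    exact absurd hs h

end Eval

end KnotDiagram

end

noncomputable section

open scoped Classical

theorem Finsupp.map_mem_of_mem_supported {R α M : Type*} [CommRing R] [AddCommGroup M]
    [Module R M] {A : Set α} {f : α →₀ R} (hf : f ∈ Finsupp.supported R R A)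
    (g : (α →₀ R) →ₗ[R] M) (V : Submodule R M) (h : ∀ s ∈ A, g (Finsupp.single s 1) ∈ V) :
    g f ∈ V := by
  rw [Finsupp.mem_supported] at hf
  rw [← Finsupp.sum_single f, Finsupp.sum, map_sum]
  refine V.sum_mem fun s hs => ?_
  rw [← mul_one (f s), ← smul_eq_mul, ← Finsupp.smul_single, map_smul]
  exact V.smul_mem _ (h s (hf hs))

namespace KnotDiagram

variable (D : KnotDiagram) (R : Type*) [CommRing R]

/-! ### Quantum degree and the number of labels x -/

/-- The circles with label `x`. -/
def labelSet (s : D.Generator) : Finset (D.Circle s.smoothing) :=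
  Finset.univ.filter fun k => s.label k = true

theorem qDegree_eq (s : D.Generator) :
    D.qDegree s = (Fintype.card (D.Circle s.smoothing) : ℤ) + D.height s.smoothing + D.nPos
      - 2 * D.nNeg - 2 * (D.labelSet s).card := by
  have h : ∀ k, (if s.label k = true then (-1 : ℤ) else 1) =
      1 - 2 * if s.label k = true then 1 else 0 := by
    intro k
    split_ifs <;> norm_num
  rw [qDegree, Finset.sum_congr rfl fun k _ => h k, Finset.sum_sub_distrib, ← Finset.mul_sum,
    Finset.sum_boole, labelSet]
  simp only [Finset.sum_const, Finset.card_univ, nsmul_eq_mul, mul_one]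
  ring

theorem qDegree_of_labelSet {S : D.Smoothing} (l : D.Circle S → Bool) (Y : Finset (D.Circle S))
    (h : ∀ k, l k = true ↔ k ∈ Y) :
    D.qDegree ⟨S, l⟩ = (Fintype.card (D.Circle S) : ℤ) + D.height S + D.nPos - 2 * D.nNeg
      - 2 * Y.card := by
  have hY : D.labelSet ⟨S, l⟩ = Y := Finset.ext fun k =>
    Finset.mem_filter.trans ((and_iff_right (Finset.mem_univ k)).trans (h k))
  rw [qDegree_eq, hY]

/-! ### The action of `x` -/

/-- As a function of colourings, x at the base point is the indicator of κ(b). Idempotence and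
commutation with the differential follow pointwise. -/
theorem eval_xAction (b : D.Arc) (i : ℤ) (S : D.Smoothing) (κ : D.Arc → Bool)
    (f : D.Cochain R i) :
    D.eval R i S κ (D.xAction R b i f) = (if κ b then 1 else 0) * D.eval R i S κ f := by
  induction f using Finsupp.induction_linear with
  | zero => simp
  | add f g hf hg => simp only [map_add, hf, hg, mul_add]
  | single s r =>
    have key : D.evalGenerator S κ (D.xGenerator b i s).1 =
        (if κ b then 1 else 0) * D.evalGenerator S κ s.1 := by
      simp only [evalGenerator, xGenerator, ite_mul, one_mul, zero_mul, ← ite_and]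
      refine if_congr ?_ rfl rfl
      constructor
      · rintro ⟨h₁, h₂, h₃⟩
        refine ⟨h₃ b (by simp), h₁, h₂, fun e he => h₃ e ?_⟩
        by_cases heb : D.circle s.1.smoothing e = D.circle s.1.smoothing b
        · rw [heb, Function.update_self]
        · rw [Function.update_of_ne heb]
          exact he
      · rintro ⟨hb, h₁, h₂, h₃⟩
        refine ⟨h₁, h₂, fun e he => ?_⟩
        by_cases heb : D.circle s.1.smoothing e = D.circle s.1.smoothing b
        · rw [h₁] at heb
          rw [h₂.eq heb, hb]
        · rw [Function.update_of_ne heb] at he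
          exact h₃ e he
    simp only [xAction, Finsupp.lmapDomain_apply, Finsupp.mapDomain_single, eval_single, key]
    push_cast
    ring

theorem xAction_xAction (b : D.Arc) (i : ℤ) (f : D.Cochain R i) :
    D.xAction R b i (D.xAction R b i f) = D.xAction R b i f := by
  refine D.ext_eval R fun S κ _ => ?_
  simp only [eval_xAction]
  split_ifs <;> simp

theorem xAction_d (b : D.Arc) (i j : ℤ) (hj : j = i + 1) (f : D.Cochain R i) :
    D.xAction R b j (D.d R i j f) = D.d R i j (D.xAction R b i f) := by
  refine D.ext_eval R fun S κ hκ => ?_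
  simp only [eval_xAction, D.eval_d R i j hj hκ, Finset.mul_sum]
  exact Finset.sum_congr rfl fun c _ => by ring

theorem qDegree_le_xGenerator (b : D.Arc) (i : ℤ) (s : D.GeneratorIn i) :
    D.qDegree s.1 - 2 ≤ D.qDegree (D.xGenerator b i s).1 := by
  have h : D.qDegree (D.xGenerator b i s).1 = _ :=
    D.qDegree_of_labelSet (Function.update s.1.label (D.circle s.1.smoothing b) true)
      (insert (D.circle s.1.smoothing b) (D.labelSet s.1)) fun k => by
        by_cases hk : k = D.circle s.1.smoothing b
        · subst hk
          simp
        · rw [Function.update_of_ne hk]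
          simp [labelSet, hk]
  have := Finset.card_insert_le (D.circle s.1.smoothing b) (D.labelSet s.1)
  rw [h, qDegree_eq]
  omega

theorem single_mem_qSpan {q i : ℤ} {s : D.GeneratorIn i} (h : q ≤ D.qDegree s.1) (r : R) :
    Finsupp.single s r ∈ D.qSpan R q i :=
  Finsupp.single_mem_supported R r h

theorem xAction_mem_qSpan (b : D.Arc) (q i : ℤ) (f : D.Cochain R i) (hf : f ∈ D.qSpan R q i) :
    D.xAction R b i f ∈ D.qSpan R (q - 2) i := by
  refine Finsupp.map_mem_of_mem_supported hf _ _ fun s hs => ?_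
  rw [xAction, Finsupp.lmapDomain_apply, Finsupp.mapDomain_single]
  refine D.single_mem_qSpan R (le_trans ?_ (D.qDegree_le_xGenerator b i s)) 1
  have : q ≤ D.qDegree s.1 := hs
  omega

/-- The generator with the label of the circle through the base point changed to `1`. -/
def unitGenerator (b : D.Arc) (i : ℤ) (s : D.GeneratorIn i) : D.GeneratorIn i :=
  ⟨⟨s.1.smoothing, Function.update s.1.label (D.circle s.1.smoothing b) false⟩, s.2⟩

theorem xGenerator_unitGenerator (b : D.Arc) (i : ℤ) (s : D.GeneratorIn i) :
    D.xGenerator b i (D.unitGenerator b i s) = D.xGenerator b i s := by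
  rw [xGenerator, xGenerator]
  refine Subtype.ext (congrArg (Generator.mk s.1.smoothing) ?_)
  exact Function.update_idem _ _ _

theorem qDegree_unitGenerator (b : D.Arc) (i : ℤ) (s : D.GeneratorIn i)
    (hs : s.1.label (D.circle s.1.smoothing b) = true) :
    D.qDegree (D.unitGenerator b i s).1 = D.qDegree s.1 + 2 := by
  have h := Finset.card_erase_add_one
    (show D.circle s.1.smoothing b ∈ D.labelSet s.1 by simpa [labelSet] using hs)
  rw [unitGenerator, D.qDegree_of_labelSet _
    ((D.labelSet s.1).erase (D.circle s.1.smoothing b)), qDegree_eq]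
  · omega
  · intro k
    by_cases hk : k = D.circle s.1.smoothing b
    · subst hk
      simp
    · rw [Function.update_of_ne hk]
      simp [labelSet, hk]

/-- The image of x is supported on generators labelled x at the base point. Relabelling that circle
by 1 raises the degree by exactly 2 and is undone by x, which accounts for q + 1 against q - 1. -/
theorem reducedBarNatan_F (b : D.Arc) (q i : ℤ) :
    (D.reducedBarNatan R b).F q i = LinearMap.range (D.xAction R b i) ⊓ D.qSpan R (q - 1) i := by
  apply le_antisymm
  · rintro _ ⟨f, hf, rfl⟩
    refine ⟨⟨f, rfl⟩, ?_⟩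
    have := D.xAction_mem_qSpan R b _ i f hf
    rwa [show q + 1 - 2 = q - 1 by ring] at this
  · rintro _ ⟨⟨f, rfl⟩, hf⟩
    let l := Finsupp.lmapDomain R R (D.unitGenerator b i)
    have hxl : ∀ g, D.xAction R b i (l g) = D.xAction R b i g := by
      intro g
      simp only [xAction, l, Finsupp.lmapDomain_apply, ← Finsupp.mapDomain_comp]
      congr 1
      exact funext (D.xGenerator_unitGenerator b i)
    refine ⟨l (D.xAction R b i f), ?_, by rw [hxl, xAction_xAction]⟩
    have hx : D.xAction R b i f ∈ Finsupp.supported R R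
        {s : D.GeneratorIn i | s.1.label (D.circle s.1.smoothing b) = true} := by
      refine Finsupp.map_mem_of_mem_supported (A := Set.univ) (by simp) _ _ fun s _ => ?_
      rw [xAction, Finsupp.lmapDomain_apply, Finsupp.mapDomain_single]
      exact Finsupp.single_mem_supported R _ (by simp [xGenerator])
    have hmem := Submodule.mem_inf.2 ⟨hf, hx⟩
    rw [qSpan, ← Finsupp.supported_inter] at hmem
    refine Finsupp.map_mem_of_mem_supported hmem _ _ fun s hs => ?_
    rw [Finsupp.lmapDomain_apply, Finsupp.mapDomain_single]
    refine D.single_mem_qSpan R ?_ 1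
    rw [D.qDegree_unitGenerator b i s hs.2]
    have : q - 1 ≤ D.qDegree s.1 := hs.1
    omega

/-! ### The involution exchanging `x` and `1 - x` -/

/-- The sign `(-1) ^ ⌊n / 2⌋`. -/
def halfSign (n : ℤ) : ℤ := (Int.negOnePow (n / 2) : ℤˣ)

theorem halfSign_mul_self (n : ℤ) : halfSign n * halfSign n = 1 := by
  rw [halfSign, ← Units.val_mul, ← Int.negOnePow_add, Int.negOnePow_even _ ⟨_, rfl⟩, Units.val_one]

theorem halfSign_add_two (n : ℤ) : halfSign (n + 2) = -halfSign n := by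
  rw [halfSign, halfSign, show (n + 2) / 2 = n / 2 + 1 by omega, Int.negOnePow_succ, Units.val_neg]

theorem halfSign_sub_two_mul (n : ℤ) (k : ℕ) :
    halfSign (n - 2 * k) = halfSign n * (-1) ^ k := by
  induction k with
  | zero => simp
  | succ k ih =>
    have h := halfSign_add_two (n - 2 * (k + 1 : ℕ))
    rw [show n - 2 * ((k + 1 : ℕ) : ℤ) + 2 = n - 2 * k by push_cast; ring, ih] at h
    rw [pow_succ]
    linarith

theorem halfSign_eq_one {n : ℤ} (h₀ : 0 ≤ n) (h₁ : n < 2) : halfSign n = 1 := by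
  rw [halfSign, show n / 2 = 0 by omega, Int.negOnePow_zero, Units.val_one]

/-- The sign with which the involution acts on the summand of the smoothing `S`. -/
def smoothingSign (q : ℤ) (S : D.Smoothing) : ℤ :=
  halfSign ((Fintype.card (D.Circle S) : ℤ) + D.height S + D.nPos - 2 * D.nNeg - q)

/-- Circles plus height is unchanged by a merge and grows by 2 under a split, so the smoothing sign
flips exactly at splits, where the weight also changes sign with the colour. -/
theorem smoothingSign_mul_edgeWeight (q : ℤ) {S T : D.Smoothing} {c : Fin D.n} (hS : S c = false)
    (hT : T = Function.update S c true) (κ : D.Arc → Bool) :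
    D.smoothingSign q T * D.edgeWeight c S T (fun e => !κ e) =
      D.smoothingSign q S * D.edgeWeight c S T κ := by
  have hoff : ∀ c', c' ≠ c → S c' = T c' := fun c' hc' => by simp [hT, hc']
  have h := D.refinesOffPair_join hoff
  have h' := D.refinesOffPair_join fun c' hc' => (hoff c' hc').symm
  have hheight : D.height T = D.height S + 1 := by rw [hT, D.height_update hS]
  simp only [edgeWeight, smoothingSign, hheight, ← Nat.card_eq_fintype_card]
  split_ifs with h₁ h₂ h₃ h₄ h₅
  · rw [h.card_quot h' h₁.1 h₁.2]
    push_cast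
    congr 2
    ring
  · simp_all
  · rw [h'.card_quot h h₂.2 h₂.1, show ((Nat.card (D.Circle S) + 1 : ℕ) : ℤ) +
      (D.height S + 1 : ℕ) + D.nPos - 2 * D.nNeg - q =
      (Nat.card (D.Circle S) : ℤ) + D.height S + D.nPos - 2 * D.nNeg - q + 2 by push_cast; ring,
      halfSign_add_two]
    ring
  · rw [h'.card_quot h h₂.2 h₂.1, show ((Nat.card (D.Circle S) + 1 : ℕ) : ℤ) +
      (D.height S + 1 : ℕ) + D.nPos - 2 * D.nNeg - q =
      (Nat.card (D.Circle S) : ℤ) + D.height S + D.nPos - 2 * D.nNeg - q + 2 by push_cast; ring,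
      halfSign_add_two]
    ring
  · simp_all
  · ring

/-- The generator with the same smoothing as `s` and with label `x` exactly on the circles in
`Y`. -/
def withLabelSet (i : ℤ) (s : D.GeneratorIn i) (Y : Finset (D.Circle s.1.smoothing)) :
    D.GeneratorIn i :=
  ⟨⟨s.1.smoothing, fun k => decide (k ∈ Y)⟩, s.2⟩

theorem withLabelSet_labelSet (i : ℤ) (s : D.GeneratorIn i) :
    D.withLabelSet i s (D.labelSet s.1) = s := by
  simp [withLabelSet, labelSet]

theorem qDegree_withLabelSet (i : ℤ) (s : D.GeneratorIn i)
    (Y : Finset (D.Circle s.1.smoothing)) :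
    D.qDegree (D.withLabelSet i s Y).1 =
      D.qDegree s.1 + 2 * (D.labelSet s.1).card - 2 * Y.card := by
  rw [withLabelSet, D.qDegree_of_labelSet _ Y fun k => decide_eq_true_iff, qDegree_eq]
  ring

/-- The involution of the Bar-Natan complex which exchanges `x` and `1 - x` on every circle, up to
a sign on every smoothing.  The sign makes it a chain map that preserves the filtration and acts on
the graded piece of quantum degree `n` by `(-1) ^ ⌊(n - q) / 2⌋`. -/
def conjugation (q i : ℤ) : D.Cochain R i →ₗ[R] D.Cochain R i :=
  Finsupp.linearCombination R fun s : D.GeneratorIn i =>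
    ((D.smoothingSign q s.1.smoothing : ℤ) : R) • ∑ Y ∈ (D.labelSet s.1).powerset,
      Finsupp.single (D.withLabelSet i s Y) ((-1) ^ Y.card)

theorem sum_evalGenerator_withLabelSet (i : ℤ) (S : D.Smoothing) (κ : D.Arc → Bool)
    (s : D.GeneratorIn i) :
    ∑ Y ∈ (D.labelSet s.1).powerset,
      (-1) ^ Y.card * D.evalGenerator S κ (D.withLabelSet i s Y).1 =
        D.evalGenerator S (fun e => !κ e) s.1 := by
  by_cases hS : s.1.smoothing = S
  swap
  · rw [show D.evalGenerator S (fun e => !κ e) s.1 = 0 from if_neg fun h => hS h.1]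
    refine Finset.sum_eq_zero fun Y _ => ?_
    rw [show D.evalGenerator S κ (D.withLabelSet i s Y).1 = 0 from if_neg fun h => hS h.1, mul_zero]
  by_cases hκ : D.Compatible S κ
  swap
  · rw [show D.evalGenerator S (fun e => !κ e) s.1 = 0 from
      if_neg fun h => hκ (by simpa using h.2.1.not)]
    refine Finset.sum_eq_zero fun Y _ => ?_
    rw [show D.evalGenerator S κ (D.withLabelSet i s Y).1 = 0 from if_neg fun h => hκ h.2.1,
      mul_zero]
  subst hS
  let K : Finset (D.Circle s.1.smoothing) := Finset.univ.filter fun k => Quot.lift κ hκ k = true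
  have h₁ : ∀ Y, D.evalGenerator s.1.smoothing κ (D.withLabelSet i s Y).1 =
      if Y ⊆ K then 1 else 0 := by
    intro Y
    refine if_congr ((and_iff_right rfl).trans ((and_iff_right hκ).trans ?_)) rfl rfl
    constructor
    · intro h k hk
      induction k using Quot.ind with
      | mk e => simpa [K] using h e (by simpa [withLabelSet] using hk)
    · intro h e he
      simpa [K] using h (show D.circle s.1.smoothing e ∈ Y by simpa [withLabelSet] using he)
  have h₂ : D.evalGenerator s.1.smoothing (fun e => !κ e) s.1 =
      if D.labelSet s.1 ∩ K = ∅ then 1 else 0 := by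
    refine if_congr ((and_iff_right rfl).trans ((and_iff_right hκ.not).trans ?_)) rfl rfl
    rw [← Finset.disjoint_iff_inter_eq_empty, Finset.disjoint_left]
    constructor
    · intro h k hk
      induction k using Quot.ind with
      | mk e => simpa [K] using h e (by simpa [labelSet] using hk)
    · intro h e he
      simpa [K] using h (show D.circle s.1.smoothing e ∈ _ by simpa [labelSet] using he)
  -- The surviving sets Y are the subsets of the x-labelled circles coloured `true`; their
  -- alternating sum is 1 if there is no such circle and 0 otherwise.
  rw [h₂, ← Finset.sum_powerset_neg_one_pow_card]
  simp only [h₁, mul_ite, mul_one, mul_zero]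
  rw [← Finset.sum_filter]
  refine Finset.sum_congr ?_ fun _ _ => rfl
  ext Y
  rw [Finset.mem_filter, Finset.mem_powerset, Finset.mem_powerset, Finset.subset_inter_iff]

/-- Up to sign, the involution is pullback along the exchange of colours. Its algebraic properties
are read off from this formula. -/
theorem eval_conjugation (q i : ℤ) (S : D.Smoothing) (κ : D.Arc → Bool) (f : D.Cochain R i) :
    D.eval R i S κ (D.conjugation R q i f) =
      (D.smoothingSign q S : R) * D.eval R i S (fun e => !κ e) f := by
  induction f using Finsupp.induction_linear with
  | zero => simp
  | add f g hf hg => simp only [map_add, hf, hg, mul_add]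
  | single s r =>
    simp only [conjugation, Finsupp.linearCombination_single, map_smul, map_sum, eval_single,
      smul_eq_mul]
    have h := congrArg (Int.cast : ℤ → R) (D.sum_evalGenerator_withLabelSet i S κ s)
    push_cast at h
    rw [h]
    by_cases hS : s.1.smoothing = S
    · rw [hS]
      ring
    · rw [show D.evalGenerator S (fun e => !κ e) s.1 = 0 from if_neg fun h => hS h.1]
      simp

theorem smoothingSign_cast_mul_self (q : ℤ) (S : D.Smoothing) :
    (D.smoothingSign q S : R) * (D.smoothingSign q S : R) = 1 := by
  rw [← Int.cast_mul, smoothingSign, halfSign_mul_self, Int.cast_one]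

theorem conjugation_conjugation (q i : ℤ) (f : D.Cochain R i) :
    D.conjugation R q i (D.conjugation R q i f) = f := by
  refine D.ext_eval R fun S κ _ => ?_
  rw [eval_conjugation, eval_conjugation, ← mul_assoc, smoothingSign_cast_mul_self]
  simp

theorem conjugation_xAction_conjugation (b : D.Arc) (q i : ℤ) (f : D.Cochain R i) :
    D.conjugation R q i (D.xAction R b i (D.conjugation R q i f)) = f - D.xAction R b i f := by
  refine D.ext_eval R fun S κ _ => ?_
  rw [eval_conjugation, eval_xAction, eval_conjugation, mul_left_comm,
    ← mul_assoc _ _ (D.eval R i S _ f), smoothingSign_cast_mul_self, map_sub, eval_xAction]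
  cases κ b <;> simp

theorem conjugation_d (q i j : ℤ) (hj : j = i + 1) (f : D.Cochain R i) :
    D.conjugation R q j (D.d R i j f) = D.d R i j (D.conjugation R q i f) := by
  refine D.ext_eval R fun T κ hκ => ?_
  rw [eval_conjugation, D.eval_d R i j hj hκ, D.eval_d R i j hj hκ.not, Finset.mul_sum]
  refine Finset.sum_congr rfl fun c _ => ?_
  rw [eval_conjugation, ← mul_assoc, ← mul_assoc, ← Int.cast_mul, ← Int.cast_mul]
  congr 2
  by_cases hc : T c = true
  · have h := D.smoothingSign_mul_edgeWeight q (S := Function.update T c false) (T := T) (c := c)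
      (by simp) (by rw [Function.update_idem, ← hc, Function.update_eq_self]) κ
    rw [diffWeight, diffWeight, if_pos hc, if_pos hc, mul_left_comm, h]
    ring
  · simp [diffWeight, hc]

/-! ### Leading terms of the involution -/

/-- In the expansion of the factors 1 - x, only the choice of -x everywhere returns `s`; every other
term has fewer labels x, hence higher degree. The two signs combine to `halfSign` of the shifted
degree. -/
theorem conjugation_single_sub_mem (q i : ℤ) (s : D.GeneratorIn i) :
    D.conjugation R q i (Finsupp.single s 1) -
      (halfSign (D.qDegree s.1 - q) : R) • Finsupp.single s 1 ∈
        D.qSpan R (D.qDegree s.1 + 2) i := by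
  have hsign : halfSign (D.qDegree s.1 - q) =
      D.smoothingSign q s.1.smoothing * (-1) ^ (D.labelSet s.1).card := by
    rw [smoothingSign, ← halfSign_sub_two_mul, qDegree_eq]
    congr 1
    ring
  rw [conjugation, Finsupp.linearCombination_single, one_smul, hsign, Int.cast_mul, mul_smul,
    ← smul_sub, ← Finset.sum_erase_add _ _ (Finset.mem_powerset_self _), withLabelSet_labelSet,
    Finsupp.smul_single, smul_eq_mul, mul_one]
  push_cast
  rw [add_sub_cancel_right]
  refine Submodule.smul_mem _ _ (Submodule.sum_mem _ fun Y hY => D.single_mem_qSpan R ?_ _)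
  rw [Finset.mem_erase, Finset.mem_powerset] at hY
  have := Finset.card_lt_card (hY.2.ssubset_of_ne hY.1)
  rw [qDegree_withLabelSet]
  omega

/-- Only the degrees r and r + 1 matter modulo filtration r + 2. For generators above them, any ε
will do. -/
theorem conjugation_single_sub_mem_of_le (q r i ε : ℤ) (s : D.GeneratorIn i)
    (hs : r ≤ D.qDegree s.1)
    (hε : D.qDegree s.1 < r + 2 → halfSign (D.qDegree s.1 - q) = ε) :
    D.conjugation R q i (Finsupp.single s 1) - (ε : R) • Finsupp.single s 1 ∈
      D.qSpan R (r + 2) i := by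
  have h := D.conjugation_single_sub_mem R q i s
  by_cases hlt : D.qDegree s.1 < r + 2
  · rw [hε hlt] at h
    exact D.qSpan_anti R _ _ (by omega) i h
  · have hs' : Finsupp.single s (1 : R) ∈ D.qSpan R (r + 2) i :=
      D.single_mem_qSpan R (not_lt.1 hlt) 1
    have h' := add_mem (D.qSpan_anti R (r + 2) _ (by omega) i h)
      (Submodule.smul_mem _ (halfSign (D.qDegree s.1 - q) : R) hs')
    rw [sub_add_cancel] at h'
    exact sub_mem h' (Submodule.smul_mem _ _ hs')

theorem conjugation_sub_mem (q i : ℤ) (f : D.Cochain R i) (hf : f ∈ D.qSpan R q i) :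
    D.conjugation R q i f - f ∈ D.qSpan R (q + 2) i := by
  refine Finsupp.map_mem_of_mem_supported hf (D.conjugation R q i - LinearMap.id) _ fun s hs => ?_
  have hs : q ≤ D.qDegree s.1 := hs
  simpa using D.conjugation_single_sub_mem_of_le R q q i 1 s hs fun h =>
    halfSign_eq_one (by omega) (by omega)

theorem conjugation_add_mem (q i : ℤ) (f : D.Cochain R i) (hf : f ∈ D.qSpan R (q + 2) i) :
    D.conjugation R q i f + f ∈ D.qSpan R (q + 4) i := by
  refine Finsupp.map_mem_of_mem_supported hf (D.conjugation R q i + LinearMap.id) _ fun s hs => ?_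
  have hs : q + 2 ≤ D.qDegree s.1 := hs
  have h := D.conjugation_single_sub_mem_of_le R q (q + 2) i (-1) s hs fun h => by
    rw [show D.qDegree s.1 - q = D.qDegree s.1 - q - 2 + 2 by ring, halfSign_add_two,
      halfSign_eq_one (by omega) (by omega)]
  rw [show q + 2 + 2 = q + 4 by ring] at h
  simpa using h

end KnotDiagram

end

/-! ### The theorem for knot diagrams -/

theorem mainTheorem9 (D : KnotDiagram) (b : D.Arc) (p : ℕ) (hp : p.Prime) :
    GradedTorsionFreeAt p (D.d ℤ) (D.reducedBarNatan ℤ b) ↔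
      GradedTorsionFreeAt p (D.d ℤ) (D.barNatan ℤ) :=
  gradedTorsionFreeAt_iff_of_involution hp (D.d ℤ) (D.barNatan ℤ) (D.reducedBarNatan ℤ b)
    (D.xAction ℤ b) (D.conjugation ℤ) (fun _ => rfl) (fun _ => rfl) (D.reducedBarNatan_F ℤ b)
    (D.xAction_xAction ℤ b) (D.xAction_d ℤ b) (D.conjugation_d ℤ) (D.conjugation_conjugation ℤ)
    (D.conjugation_xAction_conjugation ℤ b) (D.xAction_mem_qSpan ℤ b) (D.conjugation_sub_mem ℤ)
    (D.conjugation_add_mem ℤ)
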